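/- A morphism $\varphi$ of the free monoid $\mathcal{A}^*$ over a finite alphabet $\mathcal{A}$ is \emph{primitive} if there is $k\ge 1$ such that for all letters $a,b\in\mathcal{A}$ the letter $a$ occurs in $\varphi^k(b)$. It is a \emph{substitution} if there are a letter $a\in\mathcal{A}$ and a non-empty word $w\in\mathcal{A}^*$ with $\varphi(a)=aw$ and $|\varphi^n(a)|\to\infty$ as $n\to\infty$. An infinite word $\mathbf{u}=u_0u_1u_2\cdots\in\mathcal{A}^{\mathbb{N}}$ is \emph{fixed} by $\varphi$ (is a fixed point of $\varphi$) if $\varphi(u_0)\varphi(u_1)\varphi(u_2)\cdots=\mathbf{u}$. Let $w$ be a (possibly empty) factor of $\mathbf{u}$. A \emph{return word} to $w$ in $\mathbf{u}$ is a word $u_iu_{i+1}\cdots u_{j-1}$, where $i<j$ are two consecutive occurrences of $w$ in $\mathbf{u}$. If $w$ occurs infinitely often in $\mathbf{u}$ and the set of return words to $w$ is finite, say equal to $\{r_0,\dots,r_{k-1}\}$ with the $r_i$ pairwise distinct, then $\mathbf{u}=p\,r_{i_0}r_{i_1}r_{i_2}\cdots$, where $p$ is the prefix of $\mathbf{u}$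 preceding the first occurrence of $w$ and the return words $r_{i_0},r_{i_1},\dots$ are those between consecutive occurrences of $w$; the infinite word $\mathbf{d}_{\mathbf{u}}(w)=i_0i_1i_2\cdots$ over $\{0,\dots,k-1\}$ is the \emph{derived word} to $w$ in $\mathbf{u}$ (it is determined up to the numbering of the return words). A finite non-empty set $M$ of primitive substitutions (possibly over different alphabets) is \emph{closed under derivation} if for every $\varphi\in M$, every fixed point $\mathbf{u}$ of $\varphi$ and every factor $w$ of $\mathbf{u}$, the derived word $\mathbf{d}_{\mathbf{u}}(w)$ exists and, after a suitable bijective renaming of its letters, is fixed by some element of $M$. \textbf{Theorem.} Let $\psi$ be given by $a\mapsto ab$, $b\mapsto aa$; let $\nu$ be given by $0\mapsto 01$, $1\mapsto 02020101$, $2\mapsto 0202$; and let $\xi$ be given by $0\mapsto 011$, $1\mapsto 0$. Then $\psi,\xi,\nu$ are primitive substitutions, and both sets $\{\psi,\xi,\nu\}$ and $\{\xi,\nu\}$ are closed under derivation. -/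

import Mathlib

namespace DerivedWords

/-- The word `u i, u (i+1), ..., u (i+n-1)` of length `n` in the infinite word `u`. -/
def segment {A : Type} (u : ℕ → A) (i n : ℕ) : List A :=
  (List.range n).map (fun k => u (i + k))

/-- `i` is an occurrence of the finite word `w` in the infinite word `u`. -/
def IsOccurrence {A : Type} (u : ℕ → A) (w : List A) (i : ℕ) : Prop :=
  segment u i w.length = w

/-- `w` is a (possibly empty) factor of the infinite word `u`. -/
def IsFactor {A : Type} (u : ℕ → A) (w : List A) : Prop :=
  ∃ i, IsOccurrence u w i

/-- The set of return words to `w` in `u`: the words `u i, ..., u (j-1)` where `i < j` are two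
consecutive occurrences of `w` in `u`. -/
def returnWords {A : Type} (u : ℕ → A) (w : List A) : Set (List A) :=
  {r | ∃ i j, i < j ∧ IsOccurrence u w i ∧ IsOccurrence u w j ∧
    (∀ l, i < l → l < j → ¬ IsOccurrence u w l) ∧ r = segment u i (j - i)}

/-- The `n`-th occurrence (counted from `0`, in increasing order) of `w` in `u`; it is meaningful
when `w` occurs infinitely often in `u`. -/
noncomputable def nthOccurrence {A : Type} (u : ℕ → A) (w : List A) (n : ℕ) : ℕ :=
  Nat.nth (IsOccurrence u w) n

/-- The return word read in `u` between the `n`-th and the `(n+1)`-st occurrence of `w`. -/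
noncomputable def nthReturnWord {A : Type} (u : ℕ → A) (w : List A) (n : ℕ) : List A :=
  segment u (nthOccurrence u w n) (nthOccurrence u w (n + 1) - nthOccurrence u w n)

/-- `d` is the derived word to `w` in `u`, for some numbering `r 0, ..., r (k-1)` (without
repetition) of the finite set of return words to `w` in `u`: the word `w` occurs infinitely often
in `u`, and `u = p (r (d 0)) (r (d 1)) (r (d 2)) ...` where `p` is the part of `u` that precedes
the first occurrence of `w`, the cuts being exactly the occurrences of `w`. -/
def IsDerivedWord {A : Type} (u : ℕ → A) (w : List A) {k : ℕ} (d : ℕ → Fin k) : Prop :=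
  {i | IsOccurrence u w i}.Infinite ∧
    ∃ r : Fin k → List A, Function.Injective r ∧ Set.range r = returnWords u w ∧
      ∀ n, nthReturnWord u w n = r (d n)

/-- A morphism from the free monoid over a finite alphabet to itself, bundled with its alphabet
and given by the images of the letters. -/
structure Morphism where
  Alphabet : Type
  finite_alphabet : Finite Alphabet
  onLetter : Alphabet → List Alphabet

namespace Morphism

/-- The action of a morphism on finite words: concatenate the images of the letters. -/
def onWord (φ : Morphism) (x : List φ.Alphabet) : List φ.Alphabet :=
  x.flatMap φ.onLetter

/-- Some positive power of `φ` maps every letter to a word that contains all letters. -/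
def IsPrimitive (φ : Morphism) : Prop :=
  ∃ k : ℕ, 0 < k ∧ ∀ a b : φ.Alphabet, a ∈ φ.onWord^[k] [b]

/-- There are a letter `a` and a nonempty word `w` with `φ(a) = aw`, and `|φⁿ(a)| → ∞`. -/
def IsSubstitution (φ : Morphism) : Prop :=
  ∃ (a : φ.Alphabet) (w : List φ.Alphabet), w ≠ [] ∧ φ.onLetter a = a :: w ∧
    Filter.Tendsto (fun n : ℕ => (φ.onWord^[n] [a]).length) Filter.atTop Filter.atTop

/-- The infinite word `v` is `φ(u) = φ(u 0) φ(u 1) φ(u 2) ...`: the images of the prefixes of `u`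
are prefixes of `v`, of unbounded length. -/
def IsImage (φ : Morphism) (u v : ℕ → φ.Alphabet) : Prop :=
  (∀ n, φ.onWord (segment u 0 n) = segment v 0 (φ.onWord (segment u 0 n)).length) ∧
    Filter.Tendsto (fun n : ℕ => (φ.onWord (segment u 0 n)).length) Filter.atTop Filter.atTop

/-- The infinite word `u` is fixed by `φ`, that is `φ(u) = u`. -/
def Fixes (φ : Morphism) (u : ℕ → φ.Alphabet) : Prop :=
  φ.IsImage u u

end Morphism

/-- `M` is a finite nonempty set of primitive substitutions, and for every fixed point `u` of an
element of `M` and every factor `w` of `u`, the derived word to `w` in `u` exists and, for every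
numbering of the return words, is fixed, after renaming its letters by a bijection, by an
element of `M`. -/
def ClosedUnderDerivation (M : Set Morphism) : Prop :=
  M.Finite ∧ M.Nonempty ∧ (∀ φ ∈ M, φ.IsSubstitution ∧ φ.IsPrimitive) ∧
    ∀ φ ∈ M, ∀ u : ℕ → φ.Alphabet, φ.Fixes u → ∀ w : List φ.Alphabet, IsFactor u w →
      (∃ (k : ℕ) (d : ℕ → Fin k), IsDerivedWord u w d) ∧
      ∀ (k : ℕ) (d : ℕ → Fin k), IsDerivedWord u w d →
        ∃ χ ∈ M, ∃ ρ : Fin k ≃ χ.Alphabet, χ.Fixes (fun n => ρ (d n))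

/-- The two-letter alphabet `{a, b}`. -/
inductive AB : Type
  | a : AB
  | b : AB

theorem AB.finite : Finite AB :=
  Finite.of_surjective (fun t : Bool => if t then AB.a else AB.b)
    (fun x => by
      cases x
      · exact ⟨true, rfl⟩
      · exact ⟨false, rfl⟩)

/-- The period-doubling morphism `a ↦ ab`, `b ↦ aa`. -/
def psi : Morphism where
  Alphabet := AB
  finite_alphabet := AB.finite
  onLetter
    | AB.a => [AB.a, AB.b]
    | AB.b => [AB.a, AB.a]

/-- The morphism `0 ↦ 011`, `1 ↦ 0`. -/
def xi : Morphism where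
  Alphabet := Fin 2
  finite_alphabet := inferInstance
  onLetter := ![[0, 1, 1], [0]]

/-- The morphism `0 ↦ 01`, `1 ↦ 02020101`, `2 ↦ 0202`. -/
def nu : Morphism where
  Alphabet := Fin 3
  finite_alphabet := inferInstance
  onLetter := ![[0, 1], [0, 2, 0, 2, 0, 1, 0, 1], [0, 2, 0, 2]]

end DerivedWords

namespace DerivedWords

/-! ### Occurrences, return words and codings of derived words -/

section Words

variable {A D : Type}

/-! Each of `psi`, `xi`, `nu` has exactly one fixed point: the period-doubling word z
(`periodDoubling`), the word d of gaps between its letters a (`gapWord`), and the image e of d under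
0 ↦ 01, 1 ↦ 02 (`splitGapWord`). Everything reduces to the claim that a nonempty factor of z has
derived word d or e.

The claim is proved by induction on the length (`isDerivedCoding_periodDoubling`). Since z(2n) = a
and z(2n+1) is the letter other than z(n), the letter b sits only at odd positions. A factor
containing b therefore occurs in a single parity, and halving positions identifies its return words
with those of a shorter factor (`isDerivedCoding_of_desubstitution`). The letter b itself
desubstitutes to a. The factors without b are a, aa and aaa. By definition a gives d; aaa also
occurs in one parity and desubstitutes to b; aa occurs in both parities, in adjacent pairs, which
splits every gap and gives e.

For d and e, which are derived words of z to a and to aa, `exists_lift` turns a derived word of a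
derived word into a derived word of z to a longer, hence nonempty, factor. So d and e again yield
only d and e; z itself arises only from the empty factor of z. -/

@[simp] theorem segment_length (u : ℕ → A) (i n : ℕ) : (segment u i n).length = n := by
  simp [segment]

theorem segment_eq_iff {u v : ℕ → A} {i j m n : ℕ} :
    segment u i m = segment v j n ↔ m = n ∧ ∀ k < m, u (i + k) = v (j + k) := by
  constructor
  · intro h
    have hmn : m = n := by simpa using congrArg List.length h
    subst hmn
    refine ⟨rfl, fun k hk => ?_⟩
    simpa [segment, hk] using congrArg (fun l => l[k]?) h
  · rintro ⟨rfl, h⟩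
    apply List.map_congr_left
    intro k hk
    exact h k (List.mem_range.1 hk)

theorem segment_add (u : ℕ → A) (i m n : ℕ) :
    segment u i (m + n) = segment u i m ++ segment u (i + m) n := by
  simp [segment, List.range_add, Function.comp_def, add_assoc]

theorem isOccurrence_segment_iff {u : ℕ → A} {i n j : ℕ} :
    IsOccurrence u (segment u i n) j ↔ ∀ k < n, u (j + k) = u (i + k) := by
  simp [IsOccurrence, segment_eq_iff]

theorem IsFactor.exists_eq_segment {u : ℕ → A} {w : List A} (h : IsFactor u w) :
    ∃ i, w = segment u i w.length :=
  h.imp fun _ hi => hi.symm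

/-- The return words to `w` in `u`, read along an increasing enumeration of the occurrences of
`w`, are coded by the letters of `d`. -/
def IsDerivedCoding (u : ℕ → A) (w : List A) (d : ℕ → D) : Prop :=
  ∃ f : ℕ → ℕ, StrictMono f ∧ (∀ i, IsOccurrence u w i ↔ i ∈ Set.range f) ∧
    ∀ m n, segment u (f m) (f (m + 1) - f m) = segment u (f n) (f (n + 1) - f n) ↔ d m = d n

/-- A strictly increasing sequence is determined by its range, so any explicit enumeration of the
occurrences may replace `Nat.nth`. -/
theorem nthOccurrence_eq {u : ℕ → A} {w : List A} {f : ℕ → ℕ} (hf : StrictMono f)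
    (hocc : ∀ i, IsOccurrence u w i ↔ i ∈ Set.range f) (n : ℕ) : nthOccurrence u w n = f n := by
  have hset : {i | IsOccurrence u w i} = Set.range f := Set.ext hocc
  have hinf : {i | IsOccurrence u w i}.Infinite := by
    rw [hset]
    exact Set.infinite_range_of_injective hf.injective
  have h : Nat.nth (IsOccurrence u w) = f := by
    rw [← StrictMono.range_inj (Nat.nth_strictMono hinf) hf, Nat.range_nth_of_infinite hinf, hset]
  exact congrFun h n

theorem returnWords_eq_range {u : ℕ → A} {w : List A} {f : ℕ → ℕ} (hf : StrictMono f)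
    (hocc : ∀ i, IsOccurrence u w i ↔ i ∈ Set.range f) :
    returnWords u w = Set.range fun n => segment u (f n) (f (n + 1) - f n) := by
  ext r
  constructor
  · rintro ⟨i, j, hij, hi, hj, hbetween, rfl⟩
    obtain ⟨m, rfl⟩ := (hocc i).1 hi
    obtain ⟨n, rfl⟩ := (hocc j).1 hj
    have hmn : m < n := hf.lt_iff_lt.1 hij
    have hn : n = m + 1 := by
      by_contra hne
      exact hbetween (f (m + 1)) (hf (by omega)) (hf (by omega)) ((hocc _).2 ⟨_, rfl⟩)
    subst hn
    exact ⟨m, rfl⟩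
  · rintro ⟨n, rfl⟩
    refine ⟨f n, f (n + 1), hf (by omega), (hocc _).2 ⟨_, rfl⟩, (hocc _).2 ⟨_, rfl⟩, ?_, rfl⟩
    intro l h1 h2 hl
    obtain ⟨m, rfl⟩ := (hocc l).1 hl
    have := hf.lt_iff_lt.1 h1
    have := hf.lt_iff_lt.1 h2
    omega

theorem IsDerivedCoding.exists_isDerivedWord [Finite D] {u : ℕ → A} {w : List A} {d : ℕ → D}
    (h : IsDerivedCoding u w d) (hd : Function.Surjective d) :
    ∃ (k : ℕ) (d' : ℕ → Fin k), IsDerivedWord u w d' := by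
  obtain ⟨f, hf, hocc, hcode⟩ := h
  obtain ⟨k, ⟨e⟩⟩ := Finite.exists_equiv_fin D
  choose s hs using hd
  have hset : {i | IsOccurrence u w i} = Set.range f := Set.ext hocc
  refine ⟨k, fun n => e (d n), ?_, fun i => segment u (f (s (e.symm i)))
    (f (s (e.symm i) + 1) - f (s (e.symm i))), ?_, ?_, ?_⟩
  · rw [hset]
    exact Set.infinite_range_of_injective hf.injective
  · intro i j hij
    have := (hcode _ _).1 hij
    rw [hs, hs] at this
    exact e.symm.injective this
  · rw [returnWords_eq_range hf hocc]
    apply Set.Subset.antisymm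
    · rintro _ ⟨i, rfl⟩
      exact ⟨_, rfl⟩
    · rintro _ ⟨n, rfl⟩
      refine ⟨e (d n), (hcode _ _).2 ?_⟩
      rw [hs, e.symm_apply_apply]
  · intro n
    rw [nthReturnWord, nthOccurrence_eq hf hocc, nthOccurrence_eq hf hocc]
    refine (hcode _ _).2 ?_
    rw [hs, e.symm_apply_apply]

/-- Both words give equal letters exactly to equal return words, so they differ by a bijection
between the letters used; both use their whole alphabet. -/
theorem IsDerivedCoding.exists_equiv {u : ℕ → A} {w : List A} {d : ℕ → D}
    (h : IsDerivedCoding u w d) (hd : Function.Surjective d) {k : ℕ} {d' : ℕ → Fin k}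
    (h' : IsDerivedWord u w d') : ∃ ρ : Fin k ≃ D, ∀ n, ρ (d' n) = d n := by
  obtain ⟨f, hf, hocc, hcode⟩ := h
  obtain ⟨-, r, hr, hrange, hret⟩ := h'
  simp only [nthReturnWord, nthOccurrence_eq hf hocc] at hret
  have hiff : ∀ m n, d' m = d' n ↔ d m = d n := fun m n => by
    rw [← hcode, hret, hret, hr.eq_iff]
  have hsurj : Function.Surjective d' := fun i => by
    have hi : r i ∈ returnWords u w := hrange ▸ Set.mem_range_self i
    rw [returnWords_eq_range hf hocc] at hi
    obtain ⟨n, hn⟩ := hi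
    exact ⟨n, hr ((hret n).symm.trans hn)⟩
  choose s hs using hsurj
  refine ⟨Equiv.ofBijective (fun i => d (s i)) ⟨fun i j hij => ?_, fun c => ?_⟩, fun n => ?_⟩
  · rw [← hs i, ← hs j]
    exact (hiff _ _).2 hij
  · obtain ⟨n, rfl⟩ := hd c
    exact ⟨d' n, (hiff _ _).1 (hs _)⟩
  · exact (hiff _ _).1 (hs _)

/-- Equal codes give equal stretches of `u`, together with the copy of `w` that follows them. -/
theorem stretch_eq_of_code_eq {u : ℕ → A} {w : List A} {d : ℕ → D} {f : ℕ → ℕ} (hf : StrictMono f)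
    (hocc : ∀ i, IsOccurrence u w i ↔ i ∈ Set.range f)
    (hcode : ∀ m n, segment u (f m) (f (m + 1) - f m) = segment u (f n) (f (n + 1) - f n) ↔
      d m = d n) (m n l : ℕ) (h : ∀ j < l, d (m + j) = d (n + j)) :
    f (m + l) - f m = f (n + l) - f n ∧
      ∀ k < f (m + l) - f m + w.length, u (f m + k) = u (f n + k) := by
  induction l with
  | zero =>
    refine ⟨by simp, fun k hk => ?_⟩
    have h1 : segment u (f m) w.length = w := (hocc _).2 ⟨m, rfl⟩
    have h2 : segment u (f n) w.length = w := (hocc _).2 ⟨n, rfl⟩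
    exact (segment_eq_iff.1 (h1.trans h2.symm)).2 k (by simpa using hk)
  | succ l ih =>
    obtain ⟨ih1, ih2⟩ := ih fun j hj => h j (by omega)
    obtain ⟨e1, e2⟩ := segment_eq_iff.1 ((hcode _ _).2 (h l (by omega)))
    have h1 : segment u (f (m + l + 1)) w.length = w := (hocc _).2 ⟨_, rfl⟩
    have h2 : segment u (f (n + l + 1)) w.length = w := (hocc _).2 ⟨_, rfl⟩
    have e3 := (segment_eq_iff.1 (h1.trans h2.symm)).2
    have a1 : f m ≤ f (m + l) := hf.monotone (by omega)
    have a2 : f (m + l) < f (m + l + 1) := hf (by omega)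
    have a3 : f n ≤ f (n + l) := hf.monotone (by omega)
    have a4 : f (n + l) < f (n + l + 1) := hf (by omega)
    simp only [← add_assoc]
    refine ⟨by omega, fun k hk => ?_⟩
    by_cases hk1 : k < f (m + l) - f m
    · exact ih2 k (by omega)
    by_cases hk2 : k < f (m + l + 1) - f m
    · convert e2 (k - (f (m + l) - f m)) (by omega) using 2 <;> omega
    · convert e3 (k - (f (m + l + 1) - f m)) (by omega) using 2 <;> omega

/-- A stretch of `u` that starts and ends with a copy of `w` determines its code. -/
theorem code_eq_of_stretch_eq {u : ℕ → A} {w : List A} {d : ℕ → D} {f : ℕ → ℕ} (hf : StrictMono f)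
    (hocc : ∀ i, IsOccurrence u w i ↔ i ∈ Set.range f)
    (hcode : ∀ m n, segment u (f m) (f (m + 1) - f m) = segment u (f n) (f (n + 1) - f n) ↔
      d m = d n) (m n L : ℕ) (h : ∀ k < L + w.length, u (f m + k) = u (f n + k)) (l : ℕ)
    (hl : f (m + l) ≤ f m + L) :
    f (m + l) - f m = f (n + l) - f n ∧ ∀ j < l, d (m + j) = d (n + j) := by
  -- The common stretch extends by the length of `w` beyond `L`, so a copy of `w` starting at any
  -- offset up to `L` is visible on both sides.
  have hshift : ∀ t ≤ L, f m + t ∈ Set.range f ↔ f n + t ∈ Set.range f := by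
    intro t ht
    rw [← hocc, ← hocc]
    have : segment u (f m + t) w.length = segment u (f n + t) w.length :=
      segment_eq_iff.2 ⟨rfl, fun k hk => by simpa [add_assoc] using h (t + k) (by omega)⟩
    rw [IsOccurrence, this, IsOccurrence]
  induction l with
  | zero => simp
  | succ l ih =>
    have a1 : f m ≤ f (m + l) := hf.monotone (by omega)
    have a2 : f (m + l) < f (m + l + 1) := hf (by omega)
    have a3 : f n ≤ f (n + l) := hf.monotone (by omega)
    have a4 : f (n + l) < f (n + l + 1) := hf (by omega)
    simp only [← add_assoc] at hl ⊢
    obtain ⟨ih1, ih2⟩ := ih (by omega)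
    have hle : f (n + l + 1) - f n ≤ f (m + l + 1) - f m := by
      obtain ⟨q, hq⟩ := (hshift (f (m + l + 1) - f m) (by omega)).1 ⟨m + l + 1, by omega⟩
      have : n + l < q := hf.lt_iff_lt.1 (by omega)
      have : f (n + l + 1) ≤ f q := hf.monotone (by omega)
      omega
    have hge : f (m + l + 1) - f m ≤ f (n + l + 1) - f n := by
      obtain ⟨q, hq⟩ := (hshift (f (n + l + 1) - f n) (by omega)).2 ⟨n + l + 1, by omega⟩
      have : m + l < q := hf.lt_iff_lt.1 (by omega)
      have : f (m + l + 1) ≤ f q := hf.monotone (by omega)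
      omega
    refine ⟨by omega, fun j hj => ?_⟩
    rcases Nat.lt_succ_iff_lt_or_eq.1 hj with hj | rfl
    · exact ih2 j hj
    · refine (hcode _ _).1 (segment_eq_iff.2 ⟨by omega, fun k hk => ?_⟩)
      convert h (f (m + j) - f m + k) (by omega) using 2 <;> omega

/-- A factor of a derived word to `w` has the same derived word as some factor of `u` that is at
least as long as `w`. -/
theorem IsDerivedCoding.exists_lift {u : ℕ → A} {w : List A} {d : ℕ → D}
    (h : IsDerivedCoding u w d) {v : List D} (hv : IsFactor d v) :
    ∃ i n, w.length ≤ n ∧ ∀ {E : Type} (c : ℕ → E),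
      IsDerivedCoding u (segment u i n) c → IsDerivedCoding d v c := by
  obtain ⟨f, hf, hocc, hcode⟩ := h
  obtain ⟨n₀, hn₀⟩ := hv.exists_eq_segment
  generalize v.length = l at hn₀
  subst hn₀
  -- The lift of `v` is the concatenation of the return words it codes, closed by one more copy of
  -- `w`.
  refine ⟨f n₀, f (n₀ + l) - f n₀ + w.length, by omega, ?_⟩
  rintro E c ⟨F, hF, hFocc, hFcode⟩
  have hle : ∀ n l, f n ≤ f (n + l) := fun n l => hf.monotone (by omega)
  -- The lift begins with `w`, so each of its occurrences is an occurrence of `w`; `g` records which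
  -- one.
  have hrange : ∀ m, ∃ n, f n = F m := fun m => by
    refine (hocc _).1 ?_
    have h1 := isOccurrence_segment_iff.1 ((hFocc _).2 ⟨m, rfl⟩)
    have h2 : segment u (f n₀) w.length = w := (hocc _).2 ⟨n₀, rfl⟩
    refine Eq.trans (segment_eq_iff.2 ⟨rfl, fun k hk => h1 k (by omega)⟩) h2
  choose g hg using hrange
  have hgmono : StrictMono g := fun m n hmn => hf.lt_iff_lt.1 (by rw [hg, hg]; exact hF hmn)
  refine ⟨g, hgmono, fun n => ?_, fun m n => ?_⟩
  · rw [isOccurrence_segment_iff]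
    have key : n ∈ Set.range g ↔ f n ∈ Set.range F := by
      constructor
      · rintro ⟨m, rfl⟩
        exact ⟨m, (hg m).symm⟩
      · rintro ⟨m, hm⟩
        exact ⟨m, hf.injective ((hg m).trans hm)⟩
    rw [key, ← hFocc, isOccurrence_segment_iff]
    constructor
    · intro hd k hk
      have := stretch_eq_of_code_eq hf hocc hcode n₀ n l fun j hj => (hd j hj).symm
      exact (this.2 k hk).symm
    · intro hu j hj
      have := code_eq_of_stretch_eq hf hocc hcode n₀ n (f (n₀ + l) - f n₀)
        (fun k hk => (hu k hk).symm) l (by have := hle n₀ l; omega)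
      exact (this.2 j hj).symm
  · rw [← hFcode, ← hg, ← hg, ← hg, ← hg]
    have hm : g m < g (m + 1) := hgmono (by omega)
    have hn : g n < g (n + 1) := hgmono (by omega)
    obtain ⟨l₁, hl₁⟩ := Nat.exists_eq_add_of_lt hm
    obtain ⟨l₂, hl₂⟩ := Nat.exists_eq_add_of_lt hn
    constructor
    · intro hd
      obtain ⟨e1, e2⟩ := segment_eq_iff.1 hd
      have := stretch_eq_of_code_eq hf hocc hcode (g m) (g n) (l₁ + 1) fun j hj => e2 j (by omega)
      have hl : l₁ = l₂ := by omega
      subst hl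
      rw [hl₁, hl₂]
      exact segment_eq_iff.2 ⟨this.1, fun k hk => this.2 k (Nat.lt_add_right _ hk)⟩
    · intro hu
      obtain ⟨e1, e2⟩ := segment_eq_iff.1 hu
      have h1 : segment u (f (g (m + 1))) w.length = w := (hocc _).2 ⟨_, rfl⟩
      have h2 : segment u (f (g (n + 1))) w.length = w := (hocc _).2 ⟨_, rfl⟩
      have e3 := (segment_eq_iff.1 (h1.trans h2.symm)).2
      have hfm : f (g m) < f (g (m + 1)) := hf hm
      have hfn : f (g n) < f (g (n + 1)) := hf hn
      -- The code is only recoverable once the closing copy of `w` is included; here it comes from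
      -- the occurrences at the next indices.
      have := code_eq_of_stretch_eq hf hocc hcode (g m) (g n) (f (g (m + 1)) - f (g m))
        (fun k hk => by
          by_cases hk' : k < f (g (m + 1)) - f (g m)
          · exact e2 k hk'
          · convert e3 (k - (f (g (m + 1)) - f (g m))) (by omega) using 2 <;> omega)
        (l₁ + 1) (by rw [← add_assoc, ← hl₁]; omega)
      have h3 : f (g n + (l₁ + 1)) = f (g (n + 1)) := by
        rw [show g m + (l₁ + 1) = g (m + 1) by omega] at this
        have h4 := hle (g n) (l₁ + 1)
        omega
      have h4 := hf.injective h3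
      refine segment_eq_iff.2 ⟨by omega, fun j hj => this.2 j (by omega)⟩

end Words

/-! ### Morphisms all of whose images start with the same letter -/

namespace Morphism

theorem onWord_append (φ : Morphism) (x y : List φ.Alphabet) :
    φ.onWord (x ++ y) = φ.onWord x ++ φ.onWord y := by
  simp [onWord]

theorem onWord_segment_succ (φ : Morphism) (u : ℕ → φ.Alphabet) (n : ℕ) :
    φ.onWord (segment u 0 (n + 1)) = φ.onWord (segment u 0 n) ++ φ.onLetter (u n) := by
  rw [segment_add, onWord_append]
  simp [onWord, segment]

theorem fixes_of_blocks {φ : Morphism} {u : ℕ → φ.Alphabet} {p : ℕ → ℕ} (h0 : p 0 = 0)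
    (hp : StrictMono p) (h : ∀ n, φ.onLetter (u n) = segment u (p n) (p (n + 1) - p n)) :
    φ.Fixes u := by
  have key : ∀ n, φ.onWord (segment u 0 n) = segment u 0 (p n) := by
    intro n
    induction n with
    | zero => simp [h0, segment, onWord]
    | succ n ih =>
      have hlt : p n < p (n + 1) := hp (by omega)
      rw [onWord_segment_succ, ih, h]
      conv_rhs => rw [← Nat.add_sub_cancel' hlt.le, segment_add, zero_add]
  refine ⟨fun n => by rw [key, segment_length], ?_⟩
  simp only [key, segment_length]
  exact hp.tendsto_atTop

/-- Every image of a letter starts with `a`, and the image of `a` is longer than `a`. -/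
structure IsProlongable (φ : Morphism) (a : φ.Alphabet) : Prop where
  exists_eq_cons : ∀ c, ∃ w, φ.onLetter c = a :: w
  one_lt_length : 1 < (φ.onLetter a).length

theorem IsProlongable.length_onWord {φ : Morphism} {a : φ.Alphabet} (h : φ.IsProlongable a)
    (x : List φ.Alphabet) : x.length ≤ (φ.onWord x).length := by
  induction x with
  | nil => simp
  | cons c x ih =>
    obtain ⟨w, hw⟩ := h.exists_eq_cons c
    simp only [onWord, List.flatMap_cons, List.length_append, List.length_cons, hw] at ih ⊢
    omega

theorem IsProlongable.length_onWord_cons {φ : Morphism} {a : φ.Alphabet} (h : φ.IsProlongable a)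
    (x : List φ.Alphabet) : x.length + 2 ≤ (φ.onWord (a :: x)).length := by
  have h1 := h.length_onWord x
  have h2 := h.one_lt_length
  simp only [onWord, List.flatMap_cons, List.length_append] at h1 ⊢
  omega

theorem IsProlongable.isSubstitution {φ : Morphism} {a : φ.Alphabet} (h : φ.IsProlongable a) :
    φ.IsSubstitution := by
  obtain ⟨w, hw⟩ := h.exists_eq_cons a
  refine ⟨a, w, ?_, hw, ?_⟩
  · rintro rfl
    have := h.one_lt_length
    simp [hw] at this
  · have key : ∀ n, ∃ x, φ.onWord^[n] [a] = a :: x ∧ n ≤ x.length := by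
      intro n
      induction n with
      | zero => exact ⟨[], rfl, le_rfl⟩
      | succ n ih =>
        obtain ⟨x, hx, hn⟩ := ih
        have h1 := h.length_onWord_cons x
        rw [Function.iterate_succ_apply', hx]
        have h2 : φ.onWord (a :: x) = a :: (w ++ φ.onWord x) := by simp [onWord, hw]
        rw [h2] at h1 ⊢
        exact ⟨_, rfl, by simp only [List.length_cons] at h1; omega⟩
    refine Filter.tendsto_atTop_mono (fun n => ?_) Filter.tendsto_id
    obtain ⟨x, hx, hn⟩ := key n
    rw [hx]
    simp only [id, List.length_cons]
    omega

theorem Fixes.apply_zero {φ : Morphism} {a : φ.Alphabet} (h : φ.IsProlongable a)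
    {u : ℕ → φ.Alphabet} (hu : φ.Fixes u) : u 0 = a := by
  have h1 := hu.1 1
  obtain ⟨w, hw⟩ := h.exists_eq_cons (u 0)
  have h2 : φ.onWord (segment u 0 1) = a :: w := by simp [onWord, segment, hw]
  rw [h2] at h1
  simpa [segment, List.range_succ_eq_map] using (congrArg List.head? h1).symm

/-- The first letter is forced, and the image of a common prefix is a strictly longer common prefix.
-/
theorem Fixes.unique {φ : Morphism} {a : φ.Alphabet} (h : φ.IsProlongable a)
    {u v : ℕ → φ.Alphabet} (hu : φ.Fixes u) (hv : φ.Fixes v) : u = v := by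
  have key : ∀ n, segment u 0 (n + 1) = segment v 0 (n + 1) := by
    intro n
    induction n with
    | zero => simp [segment, hu.apply_zero h, hv.apply_zero h]
    | succ n ih =>
      have h1 := hu.1 (n + 1)
      rw [ih, hv.1 (n + 1)] at h1
      have h2 : n + 2 ≤ (φ.onWord (segment v 0 (n + 1))).length := by
        have h3 : segment v 0 (n + 1) = a :: segment v 1 n := by
          rw [add_comm, segment_add]
          simp [segment, hv.apply_zero h]
        rw [h3]
        simpa using h.length_onWord_cons (segment v 1 n)
      rw [segment_length] at h1
      have h4 := (segment_eq_iff.1 h1).2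
      exact segment_eq_iff.2 ⟨rfl, fun k hk => (h4 k (by omega)).symm⟩
  funext n
  simpa using (segment_eq_iff.1 (key n)).2 n (by omega)

end Morphism

/-! ### The period-doubling word -/

/-- The involution of `{a, b}` that exchanges the two letters. -/
def AB.swap : AB → AB
  | AB.a => AB.b
  | AB.b => AB.a

theorem AB.swap_injective : Function.Injective AB.swap := by
  rintro (_ | _) (_ | _) h <;> first | rfl | cases h

theorem AB.ne_a_iff {c : AB} : c ≠ AB.a ↔ c = AB.b := by cases c <;> simp

/-- The period-doubling word `abaaabab...`. -/
def periodDoubling (n : ℕ) : AB :=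
  if h : n % 2 = 0 then AB.a else AB.swap (periodDoubling (n / 2))
termination_by n
decreasing_by omega

theorem periodDoubling_two_mul (n : ℕ) : periodDoubling (2 * n) = AB.a := by
  rw [periodDoubling, dif_pos (by omega)]

theorem periodDoubling_two_mul_add_one (n : ℕ) :
    periodDoubling (2 * n + 1) = AB.swap (periodDoubling n) := by
  rw [periodDoubling, dif_neg (by omega), show (2 * n + 1) / 2 = n by omega]

theorem odd_of_periodDoubling_eq_b {n : ℕ} (h : periodDoubling n = AB.b) : n % 2 = 1 := by
  by_contra hn
  rw [show n = 2 * (n / 2) by omega, periodDoubling_two_mul] at h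
  cases h

theorem periodDoubling_succ_of_eq_b {n : ℕ} (h : periodDoubling n = AB.b) :
    periodDoubling (n + 1) = AB.a := by
  have := odd_of_periodDoubling_eq_b h
  rw [show n + 1 = 2 * ((n + 1) / 2) by omega, periodDoubling_two_mul]

/-- For either letter c, ψ(c) is a followed by the other letter. -/
theorem fixes_periodDoubling : psi.Fixes periodDoubling := by
  refine Morphism.fixes_of_blocks (p := fun n => 2 * n) rfl (fun m n h => by dsimp only; omega)
    fun n => ?_
  rw [show 2 * (n + 1) - 2 * n = 2 by omega]
  change psi.onLetter (periodDoubling n) = [periodDoubling (2 * n), periodDoubling (2 * n + 1)]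
  rw [periodDoubling_two_mul, periodDoubling_two_mul_add_one]
  cases periodDoubling n <;> rfl

/-! ### The gap word and its splitting -/

/-- The occurrences of the letter `a` in the period-doubling word. -/
def posA : ℕ → ℕ
  | 0 => 0
  | n + 1 => match periodDoubling (posA n + 1) with
    | AB.a => posA n + 1
    -- Two letters b are never adjacent, so the letter after this b is a.
    | AB.b => posA n + 2

theorem posA_succ_of_eq_a {n : ℕ} (h : periodDoubling (posA n + 1) = AB.a) :
    posA (n + 1) = posA n + 1 := by
  rw [posA, h]

theorem posA_succ_of_eq_b {n : ℕ} (h : periodDoubling (posA n + 1) = AB.b) :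
    posA (n + 1) = posA n + 2 := by
  rw [posA, h]

theorem posA_strictMono : StrictMono posA := by
  refine strictMono_nat_of_lt_succ fun n => ?_
  cases h : periodDoubling (posA n + 1)
  · rw [posA_succ_of_eq_a h]; omega
  · rw [posA_succ_of_eq_b h]; omega

theorem periodDoubling_posA (n : ℕ) : periodDoubling (posA n) = AB.a := by
  cases n with
  | zero => exact periodDoubling_two_mul 0
  | succ n =>
    cases h : periodDoubling (posA n + 1)
    · rw [posA_succ_of_eq_a h, h]
    · rw [posA_succ_of_eq_b h, periodDoubling_succ_of_eq_b h]

theorem exists_posA_eq {m : ℕ} (h : periodDoubling m = AB.a) : ∃ n, posA n = m := by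
  induction m using Nat.strong_induction_on with
  | _ m ih =>
    match m, h, ih with
    | 0, _, _ => exact ⟨0, rfl⟩
    | m + 1, h, ih =>
      cases hm : periodDoubling m with
      | a =>
        obtain ⟨n, rfl⟩ := ih m (by omega) hm
        exact ⟨n + 1, posA_succ_of_eq_a h⟩
      | b =>
        have hodd := odd_of_periodDoubling_eq_b hm
        obtain ⟨n, hn⟩ := ih (m - 1) (by omega)
          (by rw [show m - 1 = 2 * (m / 2) by omega, periodDoubling_two_mul])
        refine ⟨n + 1, ?_⟩
        rw [posA_succ_of_eq_b (by rw [hn, Nat.sub_add_cancel (by omega), hm]), hn]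
        omega

/-- The infinite word coding the gaps between the letters `a` of the period-doubling word:
`0` for a gap `2`, `1` for a gap `1`. -/
def gapWord (n : ℕ) : Fin 2 :=
  match periodDoubling (posA n + 1) with
  | AB.a => 1
  | AB.b => 0

theorem gapWord_eq_zero_iff {n : ℕ} : gapWord n = 0 ↔ periodDoubling (posA n + 1) = AB.b := by
  rw [gapWord]
  cases periodDoubling (posA n + 1) <;> simp

theorem gapWord_eq_one_iff {n : ℕ} : gapWord n = 1 ↔ periodDoubling (posA n + 1) = AB.a := by
  rw [gapWord]
  cases periodDoubling (posA n + 1) <;> simp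

theorem gapWord_eq_zero_or_one (n : ℕ) : gapWord n = 0 ∨ gapWord n = 1 := by
  generalize gapWord n = c
  revert c
  decide

theorem posA_succ_of_gapWord_eq_zero {n : ℕ} (h : gapWord n = 0) : posA (n + 1) = posA n + 2 :=
  posA_succ_of_eq_b (gapWord_eq_zero_iff.1 h)

theorem posA_succ_of_gapWord_eq_one {n : ℕ} (h : gapWord n = 1) : posA (n + 1) = posA n + 1 :=
  posA_succ_of_eq_a (gapWord_eq_one_iff.1 h)

/-- The block structure `gapWord = xi (gapWord)`, with `p n` the position of the `n`-th block. -/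
theorem exists_gapWord_blocks : ∃ p : ℕ → ℕ, p 0 = 0 ∧ StrictMono p ∧
    (∀ n, gapWord n = 0 → p (n + 1) = p n + 3 ∧ gapWord (p n) = 0 ∧ gapWord (p n + 1) = 1 ∧
      gapWord (p n + 2) = 1) ∧
    ∀ n, gapWord n = 1 → p (n + 1) = p n + 1 ∧ gapWord (p n) = 0 := by
  -- The block of the `n`-th a starts at its image under ψ, at position `2 * posA n`. A gap 2 is the
  -- word ab with image abaa, whose gaps are 2, 1, 1; a gap 1 is the word a with image ab, whose gap
  -- is 2.
  choose p hp using fun n => exists_posA_eq (periodDoubling_two_mul (posA n))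
  have hinj := posA_strictMono.injective
  have hfirst : ∀ n, gapWord (p n) = 0 := fun n => by
    rw [gapWord_eq_zero_iff, hp, periodDoubling_two_mul_add_one, periodDoubling_posA]
    rfl
  refine ⟨p, hinj (by rw [hp]; rfl), fun m n h => ?_, fun n h => ?_, fun n h => ?_⟩
  · have := posA_strictMono h
    refine posA_strictMono.lt_iff_lt.1 ?_
    rw [hp, hp]
    omega
  · have h1 := posA_succ_of_gapWord_eq_zero (hfirst n)
    have g1 : gapWord (p n + 1) = 1 := by
      rw [gapWord_eq_one_iff, h1, hp, show 2 * posA n + 2 + 1 = 2 * (posA n + 1) + 1 by ring,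
        periodDoubling_two_mul_add_one, gapWord_eq_zero_iff.1 h]
      rfl
    have h2 := posA_succ_of_gapWord_eq_one g1
    have g2 : gapWord (p n + 2) = 1 := by
      rw [gapWord_eq_one_iff, h2, h1, hp,
        show 2 * posA n + 2 + 1 + 1 = 2 * (posA n + 2) by ring, periodDoubling_two_mul]
    have h3 := posA_succ_of_gapWord_eq_one g2
    refine ⟨hinj ?_, hfirst n, g1, g2⟩
    have h4 := posA_succ_of_gapWord_eq_zero h
    have h5 := hp n
    rw [hp, h4]
    simp only [add_assoc, Nat.reduceAdd] at h2 h3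
    omega
  · refine ⟨hinj ?_, hfirst n⟩
    rw [posA_succ_of_gapWord_eq_zero (hfirst n), hp, hp, posA_succ_of_gapWord_eq_one h]
    ring

theorem fixes_gapWord : xi.Fixes gapWord := by
  obtain ⟨p, hp0, hp, h0, h1⟩ := exists_gapWord_blocks
  refine Morphism.fixes_of_blocks hp0 hp fun n => ?_
  rcases gapWord_eq_zero_or_one n with h | h
  · obtain ⟨e, a0, a1, a2⟩ := h0 n h
    simp [xi, segment, List.range_succ_eq_map, h, e, a0, a1, a2]
  · obtain ⟨e, a0⟩ := h1 n h
    simp [xi, segment, List.range_succ_eq_map, h, e, a0]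

/-- The image of `gapWord` under `0 ↦ 01`, `1 ↦ 02`. -/
def splitGapWord (n : ℕ) : Fin 3 :=
  if n % 2 = 0 then 0 else if gapWord (n / 2) = 0 then 1 else 2

theorem splitGapWord_two_mul (n : ℕ) : splitGapWord (2 * n) = 0 := by
  simp [splitGapWord]

theorem splitGapWord_two_mul_add_one (n : ℕ) :
    splitGapWord (2 * n + 1) = if gapWord n = 0 then 1 else 2 := by
  simp [splitGapWord, show (2 * n + 1) / 2 = n by omega]

theorem segment_splitGapWord_two_mul_add_two (q l : ℕ) :
    segment splitGapWord (2 * q) (l + 2) =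
      0 :: (if gapWord q = 0 then 1 else 2) :: segment splitGapWord (2 * (q + 1)) l := by
  rw [add_comm l, segment_add]
  simp [segment, List.range_succ_eq_map, splitGapWord_two_mul, splitGapWord_two_mul_add_one,
    mul_add]

/-- With σ : 0 ↦ 01, 1 ↦ 02 one has ν ∘ σ = σ ∘ ξ², so σ(d) is fixed by ν because d is fixed by ξ.
-/
theorem fixes_splitGapWord : nu.Fixes splitGapWord := by
  obtain ⟨p, hp0, hp, h0, h1⟩ := exists_gapWord_blocks
  have hfirst : ∀ n, gapWord (p n) = 0 := fun n => by
    rcases gapWord_eq_zero_or_one n with h | h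
    · exact (h0 n h).2.1
    · exact (h1 n h).2
  have hlt : ∀ n, p (p n) + 1 < p (p (n + 1)) := fun n => by
    have e := (h0 _ (hfirst n)).1
    have : p n < p (n + 1) := hp (by omega)
    have : p (p n + 1) ≤ p (p (n + 1)) := hp.monotone (by omega)
    omega
  -- Applying ξ twice sends index m to `p (p m)` and σ doubles it; a letter at an odd index comes
  -- after ν(0), which has length 2.
  refine Morphism.fixes_of_blocks (p := fun n => 2 * p (p (n / 2)) + 2 * (n % 2))
    (by simp [hp0]) (strictMono_nat_of_lt_succ fun n => ?_) fun n => ?_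
  · rcases Nat.even_or_odd' n with ⟨m, rfl | rfl⟩
    · rw [show (2 * m + 1) / 2 = m by omega, show 2 * m / 2 = m by omega]
      omega
    · rw [show (2 * m + 1 + 1) / 2 = m + 1 by omega, show (2 * m + 1) / 2 = m by omega]
      have := hlt m
      omega
  · change (![[0, 1], [0, 2, 0, 2, 0, 1, 0, 1], [0, 2, 0, 2]] : Fin 3 → List (Fin 3))
      (splitGapWord n) = segment (A := Fin 3) splitGapWord _ _
    obtain ⟨e, -, a1, a2⟩ := h0 _ (hfirst (n / 2))
    rcases Nat.even_or_odd' n with ⟨m, rfl | rfl⟩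
    · rw [show (2 * m + 1) / 2 = m by omega, show 2 * m / 2 = m by omega,
        show 2 * p (p m) + 2 * ((2 * m + 1) % 2) - (2 * p (p m) + 2 * (2 * m % 2)) = 0 + 2 by omega,
        show 2 * p (p m) + 2 * (2 * m % 2) = 2 * p (p m) by omega,
        segment_splitGapWord_two_mul_add_two, splitGapWord_two_mul, if_pos (hfirst _)]
      rfl
    · rw [show (2 * m + 1 + 1) / 2 = m + 1 by omega, show (2 * m + 1) / 2 = m by omega,
        show 2 * p (p m) + 2 * ((2 * m + 1) % 2) = 2 * (p (p m) + 1) by omega,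
        show 2 * ((2 * m + 1 + 1) % 2) = 0 by omega, splitGapWord_two_mul_add_one]
      rw [show (2 * m + 1) / 2 = m by omega] at e a1 a2
      rcases gapWord_eq_zero_or_one m with h | h
      · obtain ⟨e', -, b1, b2⟩ := h0 m h
        have c1 := h1 _ b1
        have c2 := h1 _ b2
        simp only [add_assoc, Nat.reduceAdd] at c1 c2
        have c3 : gapWord (p (p m) + 3) = 0 := by rw [← e, c1.2]
        have c4 : gapWord (p (p m) + 4) = 0 := by
          rw [show p (p m) + 4 = p (p m + 2) by omega, c2.2]
        rw [e', show 2 * p (p m + 3) + 0 - 2 * (p (p m) + 1) = 0 + 2 + 2 + 2 + 2 by omega]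
        simp only [segment_splitGapWord_two_mul_add_two, h]
        simp [a1, a2, c3, c4, segment, add_assoc]
      · rw [(h1 m h).1, e, show 2 * (p (p m) + 3) + 0 - 2 * (p (p m) + 1) = 0 + 2 + 2 by omega]
        simp only [segment_splitGapWord_two_mul_add_two, h]
        simp [a1, a2, segment, add_assoc]

/-! ### Desubstitution and the derived words of the period-doubling word -/

theorem periodDoubling_two_mul_add_eq_iff {p q t : ℕ} (ht : t % 2 = 1) :
    periodDoubling (2 * p + t) = periodDoubling (2 * q + t) ↔
      periodDoubling (p + t / 2) = periodDoubling (q + t / 2) := by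
  rw [show 2 * p + t = 2 * (p + t / 2) + 1 by omega, show 2 * q + t = 2 * (q + t / 2) + 1 by omega,
    periodDoubling_two_mul_add_one, periodDoubling_two_mul_add_one, AB.swap_injective.eq_iff]

theorem periodDoubling_two_mul_add_eq {p q t : ℕ} (ht : t % 2 = 0) :
    periodDoubling (2 * p + t) = periodDoubling (2 * q + t) := by
  rw [show 2 * p + t = 2 * (p + t / 2) by omega, show 2 * q + t = 2 * (q + t / 2) by omega,
    periodDoubling_two_mul, periodDoubling_two_mul]

/-- Stretches of the period-doubling word that start in the same phase agree if and only if
their desubstitutions agree. -/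
theorem periodDoubling_stretch_iff {p q s n : ℕ} (hs : s < 2) :
    (∀ k < n, periodDoubling (2 * p + s + k) = periodDoubling (2 * q + s + k)) ↔
      ∀ k < (s + n) / 2, periodDoubling (p + k) = periodDoubling (q + k) := by
  constructor
  · intro h k hk
    -- Only odd positions carry information, and `(s + n) / 2` counts those in the stretch.
    have := h (2 * k + 1 - s) (by omega)
    rw [show 2 * p + s + (2 * k + 1 - s) = 2 * p + (2 * k + 1) by omega,
      show 2 * q + s + (2 * k + 1 - s) = 2 * q + (2 * k + 1) by omega,
      periodDoubling_two_mul_add_eq_iff (by omega)] at this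
    rwa [show (2 * k + 1) / 2 = k by omega] at this
  · intro h k hk
    rw [add_assoc, add_assoc]
    rcases Nat.mod_two_eq_zero_or_one (s + k) with ht | ht
    · exact periodDoubling_two_mul_add_eq ht
    · rw [periodDoubling_two_mul_add_eq_iff ht]
      exact h _ (by omega)

/-- A factor of the period-doubling word whose occurrences all have the same parity has the same
derived word as its desubstitution. -/
theorem isDerivedCoding_of_desubstitution {D : Type} {d : ℕ → D} {i n s : ℕ} (hs : s < 2)
    (hparity : ∀ j, IsOccurrence periodDoubling (segment periodDoubling (2 * i + s) n) j →
      j % 2 = s)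
    (h : IsDerivedCoding periodDoubling (segment periodDoubling i ((s + n) / 2)) d) :
    IsDerivedCoding periodDoubling (segment periodDoubling (2 * i + s) n) d := by
  obtain ⟨f, hf, hocc, hcode⟩ := h
  refine ⟨fun m => 2 * f m + s, fun m m' hm => ?_, fun j => ?_, fun m m' => ?_⟩
  · have := hf hm
    dsimp only
    omega
  · have key : ∀ q, IsOccurrence periodDoubling (segment periodDoubling (2 * i + s) n)
        (2 * q + s) ↔ q ∈ Set.range f := fun q => by
      rw [← hocc, isOccurrence_segment_iff, isOccurrence_segment_iff,
        periodDoubling_stretch_iff hs]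
    constructor
    · intro hj
      have hmod := hparity j hj
      rw [show j = 2 * (j / 2) + s by omega, key] at hj
      obtain ⟨m, hm⟩ := hj
      exact ⟨m, by dsimp only; omega⟩
    · rintro ⟨m, rfl⟩
      exact (key _).2 ⟨m, rfl⟩
  · have h1 : f m < f (m + 1) := hf (by omega)
    have h2 : f m' < f (m' + 1) := hf (by omega)
    dsimp only
    rw [← hcode, segment_eq_iff, segment_eq_iff, periodDoubling_stretch_iff hs,
      show (s + (2 * f (m + 1) + s - (2 * f m + s))) / 2 = f (m + 1) - f m by omega]
    refine and_congr_left fun _ => ?_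
    omega

theorem isDerivedCoding_a :
    IsDerivedCoding periodDoubling (segment periodDoubling 0 1) gapWord := by
  refine ⟨posA, posA_strictMono, fun i => ?_, fun m n => ?_⟩
  · have h0 : periodDoubling 0 = AB.a := periodDoubling_two_mul 0
    rw [isOccurrence_segment_iff]
    constructor
    · intro h
      exact exists_posA_eq ((h 0 (by omega)).trans h0)
    · rintro ⟨n, rfl⟩ k hk
      obtain rfl : k = 0 := by omega
      exact (periodDoubling_posA n).trans h0.symm
  · rw [segment_eq_iff]
    rcases gapWord_eq_zero_or_one m with hm | hm <;> rcases gapWord_eq_zero_or_one n with hn | hn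
    all_goals
      simp only [posA_succ_of_gapWord_eq_zero, posA_succ_of_gapWord_eq_one, hm, hn,
        Nat.add_sub_cancel_left]
    · simp only [true_and, iff_true]
      intro k hk
      obtain rfl | rfl : k = 0 ∨ k = 1 := by omega
      · rw [add_zero, add_zero, periodDoubling_posA, periodDoubling_posA]
      · rw [gapWord_eq_zero_iff.1 hm, gapWord_eq_zero_iff.1 hn]
    · simp
    · simp
    · simp only [true_and, iff_true]
      intro k hk
      obtain rfl : k = 0 := by omega
      rw [add_zero, add_zero, periodDoubling_posA, periodDoubling_posA]

theorem isDerivedCoding_of_eq_a {i : ℕ} (h : periodDoubling i = AB.a) :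
    IsDerivedCoding periodDoubling (segment periodDoubling i 1) gapWord := by
  have : segment periodDoubling i 1 = segment periodDoubling 0 1 :=
    segment_eq_iff.2 ⟨rfl, fun k hk => by
      obtain rfl : k = 0 := by omega
      exact h.trans (periodDoubling_two_mul 0).symm⟩
  rw [this]
  exact isDerivedCoding_a

theorem isDerivedCoding_of_eq_b {i : ℕ} (h : periodDoubling i = AB.b) :
    IsDerivedCoding periodDoubling (segment periodDoubling i 1) gapWord := by
  have hi := odd_of_periodDoubling_eq_b h
  have hi' : i = 2 * (i / 2) + 1 := by omega
  rw [hi']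
  refine isDerivedCoding_of_desubstitution (by omega) (fun j hj => ?_)
    (isDerivedCoding_of_eq_a ?_)
  · rw [← hi'] at hj
    exact odd_of_periodDoubling_eq_b ((isOccurrence_segment_iff.1 hj 0 (by omega)).trans h)
  · rw [hi', periodDoubling_two_mul_add_one] at h
    exact AB.swap_injective h

/-- Of `j` and `j + 1`, the even one carries a automatically, and the odd one is `2 * (j / 2) + 1`
whatever the parity of `j`. -/
theorem periodDoubling_eq_a_and_succ_iff {j : ℕ} :
    (periodDoubling j = AB.a ∧ periodDoubling (j + 1) = AB.a) ↔
      periodDoubling (j / 2) = AB.b := by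
  rcases Nat.even_or_odd' j with ⟨m, rfl | rfl⟩
  · rw [periodDoubling_two_mul, periodDoubling_two_mul_add_one, show 2 * m / 2 = m by omega]
    cases periodDoubling m <;> simp [AB.swap]
  · rw [show 2 * m + 1 + 1 = 2 * (m + 1) by ring, periodDoubling_two_mul,
      periodDoubling_two_mul_add_one, show (2 * m + 1) / 2 = m by omega]
    cases periodDoubling m <;> simp [AB.swap]

/-- Each b, at position g, produces the two occurrences 2g and 2g + 1 of aa. Hence the return word a
(letter 0) alternates with longer ones, which correspond to the return words to b and so are coded
by d. -/
theorem isDerivedCoding_aa {i : ℕ} (h0 : periodDoubling i = AB.a)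
    (h1 : periodDoubling (i + 1) = AB.a) :
    IsDerivedCoding periodDoubling (segment periodDoubling i 2) splitGapWord := by
  have hb : periodDoubling 1 = AB.b := periodDoubling_two_mul_add_one 0 |>.trans (by
    rw [show periodDoubling 0 = AB.a from periodDoubling_two_mul 0]; rfl)
  obtain ⟨g, hg, hocc, hcode⟩ := isDerivedCoding_of_eq_b hb
  have hocc' : ∀ j, periodDoubling j = AB.b ↔ j ∈ Set.range g := fun j => by
    rw [← hocc, isOccurrence_segment_iff]
    simp [hb]
  -- Gaps of at least 2 between the letters b make the long return words have length at least 3, so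
  -- they differ from a.
  have hgap : ∀ m, g m + 2 ≤ g (m + 1) := fun m => by
    have e1 := odd_of_periodDoubling_eq_b ((hocc' _).2 ⟨m, rfl⟩)
    have e2 := odd_of_periodDoubling_eq_b ((hocc' _).2 ⟨m + 1, rfl⟩)
    have : g m < g (m + 1) := hg (by omega)
    omega
  have hsplit : ∀ m n, splitGapWord (2 * m + 1) = splitGapWord (2 * n + 1) ↔
      gapWord m = gapWord n := fun m n => by
    rw [splitGapWord_two_mul_add_one, splitGapWord_two_mul_add_one]
    rcases gapWord_eq_zero_or_one m with hm | hm <;>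
      rcases gapWord_eq_zero_or_one n with hn | hn <;> simp [hm, hn]
  have hne : ∀ m n, splitGapWord (2 * m) ≠ splitGapWord (2 * n + 1) := fun m n => by
    rw [splitGapWord_two_mul, splitGapWord_two_mul_add_one]
    split_ifs <;> decide
  have heven : ∀ m, 2 * g ((2 * m + 1) / 2) + (2 * m + 1) % 2 -
      (2 * g (2 * m / 2) + 2 * m % 2) = 1 := fun m => by
    rw [show (2 * m + 1) / 2 = m by omega, show 2 * m / 2 = m by omega]
    omega
  have hodd : ∀ m, 2 * g ((2 * m + 1 + 1) / 2) + (2 * m + 1 + 1) % 2 -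
      (2 * g ((2 * m + 1) / 2) + (2 * m + 1) % 2) = 2 * (g (m + 1) - g m) - 1 := fun m => by
    rw [show (2 * m + 1) / 2 = m by omega, show (2 * m + 1 + 1) / 2 = m + 1 by omega]
    omega
  refine ⟨fun n => 2 * g (n / 2) + n % 2, strictMono_nat_of_lt_succ fun n => ?_, fun j => ?_,
    fun m n => ?_⟩
  · rcases Nat.even_or_odd' n with ⟨m, rfl | rfl⟩
    · have := heven m
      omega
    · have := hodd m
      have := hgap m
      omega
  · have key : IsOccurrence periodDoubling (segment periodDoubling i 2) j ↔
        periodDoubling j = AB.a ∧ periodDoubling (j + 1) = AB.a := by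
      rw [isOccurrence_segment_iff]
      constructor
      · intro h
        exact ⟨(h 0 (by omega)).trans h0, (h 1 (by omega)).trans h1⟩
      · rintro ⟨e0, e1⟩ k hk
        obtain rfl | rfl : k = 0 ∨ k = 1 := by omega
        · exact e0.trans h0.symm
        · exact e1.trans h1.symm
    rw [key, periodDoubling_eq_a_and_succ_iff, hocc']
    constructor
    · rintro ⟨m, hm⟩
      refine ⟨2 * m + j % 2, ?_⟩
      dsimp only
      rw [show (2 * m + j % 2) / 2 = m by omega, hm]
      omega
    · rintro ⟨n, rfl⟩
      exact ⟨n / 2, by dsimp only; omega⟩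
  · rcases Nat.even_or_odd' m with ⟨m, rfl | rfl⟩ <;> rcases Nat.even_or_odd' n with ⟨n, rfl | rfl⟩
    · rw [heven, heven, segment_eq_iff, splitGapWord_two_mul, splitGapWord_two_mul]
      simp only [true_and, iff_true]
      intro k hk
      obtain rfl : k = 0 := by omega
      rw [show 2 * g (2 * m / 2) + 2 * m % 2 + 0 = 2 * g (2 * m / 2) by omega,
        show 2 * g (2 * n / 2) + 2 * n % 2 + 0 = 2 * g (2 * n / 2) by omega,
        periodDoubling_two_mul, periodDoubling_two_mul]
    · refine iff_of_false (fun h => ?_) (hne m n)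
      have := (segment_eq_iff.1 h).1
      rw [heven, hodd] at this
      have := hgap n
      omega
    · refine iff_of_false (fun h => ?_) (hne n m).symm
      have := (segment_eq_iff.1 h).1
      rw [heven, hodd] at this
      have := hgap m
      omega
    · dsimp only
      rw [hsplit, ← hcode, hodd, hodd, show (2 * m + 1) / 2 = m by omega,
        show (2 * n + 1) / 2 = n by omega, show (2 * m + 1) % 2 = 1 by omega,
        show (2 * n + 1) % 2 = 1 by omega, segment_eq_iff, segment_eq_iff,
        periodDoubling_stretch_iff (by omega)]
      have := hgap m
      have := hgap n
      rw [show (1 + (2 * (g (m + 1) - g m) - 1)) / 2 = g (m + 1) - g m by omega]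
      refine and_congr_left fun _ => ?_
      omega

/-- The word aaaa at `i` would force b at the consecutive positions `i / 2` and `i / 2 + 1`, which
cannot both be odd. -/
theorem exists_eq_b_of_four_le {i n : ℕ} (hn : 4 ≤ n) : ∃ k < n, periodDoubling (i + k) = AB.b := by
  by_contra! h
  have h0 : ∀ k < 4, periodDoubling (i + k) = AB.a := fun k hk => by
    by_contra hne
    exact h k (by omega) (AB.ne_a_iff.1 hne)
  have e1 := periodDoubling_eq_a_and_succ_iff.1 ⟨h0 0 (by omega), h0 1 (by omega)⟩
  have e2 := periodDoubling_eq_a_and_succ_iff.1 ⟨h0 2 (by omega), h0 3 (by omega)⟩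
  have o1 := odd_of_periodDoubling_eq_b e1
  have o2 := odd_of_periodDoubling_eq_b e2
  omega

/-- The derived word to a nonempty factor of the period-doubling word is `gapWord` or
`splitGapWord`. -/
theorem isDerivedCoding_periodDoubling (n : ℕ) : ∀ i, 0 < n →
    IsDerivedCoding periodDoubling (segment periodDoubling i n) gapWord ∨
      IsDerivedCoding periodDoubling (segment periodDoubling i n) splitGapWord := by
  induction n using Nat.strong_induction_on with
  | _ n ih =>
    intro i hn
    by_cases hb : ∃ k < n, periodDoubling (i + k) = AB.b
    · obtain ⟨k, hk, hkb⟩ := hb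
      -- Length 1 is separate because desubstituting b yields a factor of the same length.
      rcases Nat.lt_or_ge n 2 with h2 | h2
      · obtain rfl : n = 1 := by omega
        obtain rfl : k = 0 := by omega
        exact Or.inl (isDerivedCoding_of_eq_b hkb)
      have hodd := odd_of_periodDoubling_eq_b hkb
      have hparity : ∀ j, IsOccurrence periodDoubling
          (segment periodDoubling (2 * (i / 2) + i % 2) n) j → j % 2 = i % 2 := fun j hj => by
        rw [show 2 * (i / 2) + i % 2 = i by omega, isOccurrence_segment_iff] at hj
        have := odd_of_periodDoubling_eq_b ((hj k hk).trans hkb)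
        omega
      have hs : i % 2 < 2 := by omega
      rw [show i = 2 * (i / 2) + i % 2 by omega]
      have h1 : ¬ (i % 2 = 0 ∧ n = 1) := by omega
      exact (ih ((i % 2 + n) / 2) (by omega) (i / 2) (by omega)).imp
        (isDerivedCoding_of_desubstitution hs hparity)
        (isDerivedCoding_of_desubstitution hs hparity)
    · have hn4 : n < 4 := by
        by_contra h4
        exact hb (exists_eq_b_of_four_le (by omega))
      have ha : ∀ k < n, periodDoubling (i + k) = AB.a := fun k hk => by
        by_contra hne
        exact hb ⟨k, hk, AB.ne_a_iff.1 hne⟩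
      obtain rfl | rfl | rfl : n = 1 ∨ n = 2 ∨ n = 3 := by omega
      · exact Or.inl (isDerivedCoding_of_eq_a (ha 0 (by omega)))
      · exact Or.inr (isDerivedCoding_aa (ha 0 (by omega)) (ha 1 (by omega)))
      -- Both `j / 2` and `(j + 1) / 2` carry b, hence are odd, hence coincide; so `j` is even.
      · have haaa : ∀ j, (∀ k < 3, periodDoubling (j + k) = AB.a) →
            j % 2 = 0 ∧ periodDoubling (j / 2) = AB.b := fun j hj => by
          have e1 := periodDoubling_eq_a_and_succ_iff.1 ⟨hj 0 (by omega), hj 1 (by omega)⟩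
          have e2 := periodDoubling_eq_a_and_succ_iff.1 ⟨hj 1 (by omega), hj 2 (by omega)⟩
          have o1 := odd_of_periodDoubling_eq_b e1
          have o2 := odd_of_periodDoubling_eq_b e2
          exact ⟨by omega, e1⟩
        obtain ⟨hi, hib⟩ := haaa i ha
        rw [show i = 2 * (i / 2) + 0 by omega]
        refine Or.inl (isDerivedCoding_of_desubstitution (by omega) (fun j hj => ?_)
          (isDerivedCoding_of_eq_b hib))
        rw [show 2 * (i / 2) + 0 = i by omega, isOccurrence_segment_iff] at hj
        exact (haaa j fun k hk => (hj k hk).trans (ha k hk)).1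

/-! ### Closure under derivation -/

theorem isDerivedCoding_nil {A : Type} (u : ℕ → A) : IsDerivedCoding u [] u := by
  refine ⟨id, strictMono_id, fun i => by simp [IsOccurrence, segment], fun m n => ?_⟩
  simp [segment]

/-- The lifted factor has length at least `n > 0`, so the classification for z applies even when `w`
is empty. -/
theorem isDerivedCoding_of_isFactor_derived {D : Type} {d : ℕ → D} {i n : ℕ} (hn : 0 < n)
    (hd : IsDerivedCoding periodDoubling (segment periodDoubling i n) d) {w : List D}
    (hw : IsFactor d w) : IsDerivedCoding d w gapWord ∨ IsDerivedCoding d w splitGapWord := by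
  obtain ⟨j, l, hl, hlift⟩ := hd.exists_lift hw
  rw [segment_length] at hl
  exact (isDerivedCoding_periodDoubling l j (by omega)).imp (hlift _) (hlift _)

theorem gapWord_surjective : Function.Surjective gapWord := by
  obtain ⟨p, hp0, hp, h0, h1⟩ := exists_gapWord_blocks
  have h : gapWord 0 = 0 := by
    rcases gapWord_eq_zero_or_one 0 with h | h
    · exact h
    · simpa [hp0] using (h1 0 h).2
  intro c
  obtain ⟨-, -, e, -⟩ := h0 0 h
  fin_cases c
  · exact ⟨0, h⟩
  · exact ⟨_, e⟩

theorem splitGapWord_surjective : Function.Surjective splitGapWord := by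
  intro c
  obtain ⟨m, hm⟩ := gapWord_surjective 0
  obtain ⟨n, hn⟩ := gapWord_surjective 1
  fin_cases c
  · exact ⟨2 * 0, splitGapWord_two_mul 0⟩
  · exact ⟨2 * m + 1, by rw [splitGapWord_two_mul_add_one, hm]; rfl⟩
  · exact ⟨2 * n + 1, by rw [splitGapWord_two_mul_add_one, hn]; rfl⟩

theorem periodDoubling_surjective : Function.Surjective periodDoubling := by
  have h0 : periodDoubling 0 = AB.a := periodDoubling_two_mul 0
  rintro (_ | _)
  · exact ⟨0, h0⟩
  · exact ⟨2 * 0 + 1, by rw [periodDoubling_two_mul_add_one, h0]; rfl⟩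

theorem psi_isProlongable : psi.IsProlongable AB.a where
  exists_eq_cons c := by cases c <;> exact ⟨_, rfl⟩
  one_lt_length := by decide

theorem xi_isProlongable : xi.IsProlongable (0 : Fin 2) where
  exists_eq_cons := by
    intro (c : Fin 2)
    fin_cases c <;> exact ⟨_, rfl⟩
  one_lt_length := by decide

theorem nu_isProlongable : nu.IsProlongable (0 : Fin 3) where
  exists_eq_cons := by
    intro (c : Fin 3)
    fin_cases c <;> exact ⟨_, rfl⟩
  one_lt_length := by decide

theorem psi_isPrimitive : psi.IsPrimitive := by
  refine ⟨2, by omega, ?_⟩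
  rintro (_ | _) (_ | _) <;>
    first
    | exact List.mem_cons_self
    | exact List.mem_cons_of_mem _ List.mem_cons_self

theorem xi_isPrimitive : xi.IsPrimitive := by
  refine ⟨2, by omega, ?_⟩
  let l : Fin 2 → List (Fin 2) := ![[0, 1, 1], [0]]
  change ∀ a b : Fin 2, a ∈ ([b].flatMap l).flatMap l
  decide

theorem nu_isPrimitive : nu.IsPrimitive := by
  refine ⟨2, by omega, ?_⟩
  let l : Fin 3 → List (Fin 3) := ![[0, 1], [0, 2, 0, 2, 0, 1, 0, 1], [0, 2, 0, 2]]
  change ∀ a b : Fin 3, a ∈ ([b].flatMap l).flatMap l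
  decide

/-- One surjective coding per factor suffices: it yields a derived word, and every other numbering
is a renaming of it. -/
theorem closedUnderDerivation_of_coding {M : Set Morphism} (hfin : M.Finite) (hne : M.Nonempty)
    (hsub : ∀ φ ∈ M, φ.IsSubstitution ∧ φ.IsPrimitive)
    (h : ∀ φ ∈ M, ∀ u : ℕ → φ.Alphabet, φ.Fixes u → ∀ w, IsFactor u w →
      ∃ χ ∈ M, ∃ c : ℕ → χ.Alphabet, χ.Fixes c ∧ Function.Surjective c ∧ IsDerivedCoding u w c) :
    ClosedUnderDerivation M := by
  refine ⟨hfin, hne, hsub, fun φ hφ u hu w hw => ?_⟩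
  obtain ⟨χ, hχ, c, hc, hsurj, hcode⟩ := h φ hφ u hu w hw
  have := χ.finite_alphabet
  refine ⟨hcode.exists_isDerivedWord hsurj, fun k d hd => ?_⟩
  obtain ⟨ρ, hρ⟩ := hcode.exists_equiv hsurj hd
  exact ⟨χ, hχ, ρ, by simpa only [hρ] using hc⟩

theorem exists_coding_of_xi_nu_mem {M : Set Morphism} (hxi : xi ∈ M) (hnu : nu ∈ M) {A : Type}
    {u : ℕ → A} {w : List A} (h : IsDerivedCoding u w gapWord ∨ IsDerivedCoding u w splitGapWord) :
    ∃ χ ∈ M, ∃ c : ℕ → χ.Alphabet,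
      χ.Fixes c ∧ Function.Surjective c ∧ IsDerivedCoding u w c := by
  rcases h with h | h
  · exact ⟨xi, hxi, gapWord, fixes_gapWord, gapWord_surjective, h⟩
  · exact ⟨nu, hnu, splitGapWord, fixes_splitGapWord, splitGapWord_surjective, h⟩

theorem isDerivedCoding_of_fixes_xi {u : ℕ → Fin 2} (hu : xi.Fixes u) {w : List (Fin 2)}
    (hw : IsFactor u w) : IsDerivedCoding u w gapWord ∨ IsDerivedCoding u w splitGapWord := by
  obtain rfl : u = gapWord := Morphism.Fixes.unique xi_isProlongable hu fixes_gapWord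
  exact isDerivedCoding_of_isFactor_derived one_pos isDerivedCoding_a hw

theorem isDerivedCoding_of_fixes_nu {u : ℕ → Fin 3} (hu : nu.Fixes u) {w : List (Fin 3)}
    (hw : IsFactor u w) : IsDerivedCoding u w gapWord ∨ IsDerivedCoding u w splitGapWord := by
  obtain rfl : u = splitGapWord := Morphism.Fixes.unique nu_isProlongable hu fixes_splitGapWord
  obtain ⟨n, hn⟩ := periodDoubling_surjective AB.b
  obtain ⟨h0, h1⟩ := periodDoubling_eq_a_and_succ_iff.2
    (show periodDoubling (2 * n / 2) = AB.b by rwa [Nat.mul_div_cancel_left _ two_pos])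
  exact isDerivedCoding_of_isFactor_derived two_pos (isDerivedCoding_aa h0 h1) hw

end DerivedWords

theorem mainTheorem2 :
    DerivedWords.ClosedUnderDerivation {DerivedWords.psi, DerivedWords.xi, DerivedWords.nu} ∧
    DerivedWords.ClosedUnderDerivation {DerivedWords.xi, DerivedWords.nu} := by
  open DerivedWords in
  have hpsi := And.intro psi_isProlongable.isSubstitution psi_isPrimitive
  have hxi := And.intro xi_isProlongable.isSubstitution xi_isPrimitive
  have hnu := And.intro nu_isProlongable.isSubstitution nu_isPrimitive
  constructor
  · refine closedUnderDerivation_of_coding (Set.toFinite _) ⟨psi, by simp⟩ ?_ ?_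
    · rintro φ (rfl | rfl | rfl) <;> assumption
    · rintro φ (rfl | rfl | rfl) u hu w hw
      · obtain rfl : u = periodDoubling :=
          Morphism.Fixes.unique psi_isProlongable hu fixes_periodDoubling
        obtain ⟨i, hi⟩ := hw.exists_eq_segment
        rcases Nat.eq_zero_or_pos w.length with h0 | h0
        · rw [List.length_eq_zero_iff] at h0
          subst h0
          exact ⟨psi, by simp, periodDoubling, fixes_periodDoubling, periodDoubling_surjective,
            isDerivedCoding_nil _⟩
        · refine exists_coding_of_xi_nu_mem (by simp) (by simp) ?_
          rw [hi]
          exact isDerivedCoding_periodDoubling _ i h0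
      · exact exists_coding_of_xi_nu_mem (by simp) (by simp) (isDerivedCoding_of_fixes_xi hu hw)
      · exact exists_coding_of_xi_nu_mem (by simp) (by simp) (isDerivedCoding_of_fixes_nu hu hw)
  · refine closedUnderDerivation_of_coding (Set.toFinite _) ⟨xi, by simp⟩ ?_ ?_
    · rintro φ (rfl | rfl) <;> assumption
    · rintro φ (rfl | rfl) u hu w hw
      · exact exists_coding_of_xi_nu_mem (by simp) (by simp) (isDerivedCoding_of_fixes_xi hu hw)
      · exact exists_coding_of_xi_nu_mem (by simp) (by simp) (isDerivedCoding_of_fixes_nu hu hw)
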